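/- Fix $\sigma>0$, $A>0$ and a real random variable $h$ with an arbitrary distribution. In the slow fading channel $\mathcal G_{slow}$ the input $\mathbf x\in\mathbb R^n$ produces the output $\mathbf y=h\mathbf x+\mathbf z$, where $\mathbf z$ has i.i.d. $N(0,\sigma^2)$ coordinates, with density $f_{\mathbf z}$, and is independent of $h$; the receiver knows $h$ (channel side information, CSI). For $\eta\in\mathbb R$, an $(M,n,\lambda_1,\lambda_2,\eta)$ deterministic identification (DI) code consists of codewords $\mathbf u_1,\dots,\mathbf u_M\in\mathbb R^n$ with $\|\mathbf u_i\|_2^2\le nA$ and measurable decoding regions $D_{i,x}\subset\mathbb R^n$ ($1\le i\le M$, $x\in\mathbb R$) such that, for some Borel set $H_0\subset\mathbb R$ with $\mathbb P(h\in H_0)\ge 1-\eta$, $$\int_{D_{i,x}^c} f_{\mathbf z}(\mathbf y-x\mathbf u_i)\,d\mathbf y\le\lambda_1,\qquad \int_{D_{j,x}} f_{\mathbf z}(\mathbf y-x\mathbf u_i)\,d\mathbf y\le\lambda_2$$ for all $x\in H_0$ and all $i\ne j$ (the first inequality for all $i$). A rate $R>0$ is achievable for the outage probability $\eta$ if for all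 $\lambda_1,\lambda_2>0$ and all sufficiently large $n$ there is a $(\lceil n^{nR}\rceil,n,\lambda_1,\lambda_2,\eta)$ DI code. The capacity $C_{DI}^{CSI}(\mathcal G_{slow},\eta)$ is the supremum of the achievable rates ($0$ if there are none). 1. If $\eta<\mathbb P(h=0)$, then $C_{DI}^{CSI}(\mathcal G_{slow},\eta)=0$. In fact, every $(M,n,\lambda_1,\lambda_2,\eta)$ DI code with $\lambda_1+\lambda_2<1$ has $M\le 1$. 2. If $\mathbb P(h=0)<\eta<1$, then $$\frac14\le C_{DI}^{CSI}(\mathcal G_{slow},\eta)\le\frac12 .$$ -/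

import Mathlib

open MeasureTheory Filter
open scoped ENNReal

noncomputable section

namespace SlowFading

/-- The density of the noise vector `(z₁, …, zₙ)`, whose coordinates are i.i.d. `N(0, σ²)`. -/
def noiseDensity (σ : ℝ) (n : ℕ) (z : EuclideanSpace ℝ (Fin n)) : ℝ :=
  1 / (2 * Real.pi * σ ^ 2) ^ ((n : ℝ) / 2) * Real.exp (-‖z‖ ^ 2 / (2 * σ ^ 2))

/-- A system of `M` codewords in `ℝⁿ` under the input constraint `A`, with decoding regions that
may depend on the fading coefficient (which the receiver knows). -/
structure DICode (M n : ℕ) (A : ℝ) where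
  /-- the codewords `uᵢ` -/
  codeword : Fin M → EuclideanSpace ℝ (Fin n)
  /-- the decoding regions `D_{i,h}` -/
  region : Fin M → ℝ → Set (EuclideanSpace ℝ (Fin n))
  norm_sq_le : ∀ i, ‖codeword i‖ ^ 2 ≤ n * A
  measurableSet_region : ∀ i h, MeasurableSet (region i h)

namespace DICode

variable {M n : ℕ} {A : ℝ}

/-- Type I (missed identification) error for the identity `i` and the fading coefficient `h`. -/
def errorI (𝒞 : DICode M n A) (σ : ℝ) (i : Fin M) (h : ℝ) : ℝ :=
  ∫ y in (𝒞.region i h)ᶜ, noiseDensity σ n (y - h • 𝒞.codeword i)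

/-- Type II (false identification) error: `i` is sent, and the receiver that expects `j`
accepts. -/
def errorII (𝒞 : DICode M n A) (σ : ℝ) (i j : Fin M) (h : ℝ) : ℝ :=
  ∫ y in 𝒞.region j h, noiseDensity σ n (y - h • 𝒞.codeword i)

/-- The code is an `(M, n, lam₁, lam₂, η)` DI code: off an outage event of probability at most `η`,
all errors, uniformly in the fading coefficient, are at most `lam₁` and `lam₂`. -/
def IsReliable {Ω : Type*} [MeasurableSpace Ω] (𝒞 : DICode M n A) (σ : ℝ) (P : Measure Ω)
    (h : Ω → ℝ) (lam₁ lam₂ η : ℝ) : Prop :=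
  ∃ H₀ : Set ℝ, MeasurableSet H₀ ∧ 1 - η ≤ P.real {ω | h ω ∈ H₀} ∧
    (∀ i, ∀ x ∈ H₀, 𝒞.errorI σ i x ≤ lam₁) ∧
    (∀ i j, i ≠ j → ∀ x ∈ H₀, 𝒞.errorII σ i j x ≤ lam₂)

end DICode

/-- There is an `(M, n, lam₁, lam₂, η)` DI code for the slow fading channel with noise variance
`σ²`, fading coefficient `h` and input constraint `A`. -/
def ExistsDICode {Ω : Type*} [MeasurableSpace Ω] (σ A : ℝ) (P : Measure Ω) (h : Ω → ℝ)
    (M n : ℕ) (lam₁ lam₂ η : ℝ) : Prop :=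
  ∃ 𝒞 : DICode M n A, 𝒞.IsReliable σ P h lam₁ lam₂ η

/-- The rate `R > 0` is achievable for the outage probability `η`. The number `n ^ (n R)` of
codewords is rounded up to an integer. -/
def IsAchievable {Ω : Type*} [MeasurableSpace Ω] (σ A : ℝ) (P : Measure Ω) (h : Ω → ℝ)
    (η R : ℝ) : Prop :=
  0 < R ∧ ∀ lam₁ lam₂ : ℝ, 0 < lam₁ → 0 < lam₂ →
    ∀ᶠ n : ℕ in atTop, ExistsDICode σ A P h ⌈(n : ℝ) ^ ((n : ℝ) * R)⌉₊ n lam₁ lam₂ η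

/-- The `η`-outage DI capacity with channel side information: the supremum, in `[0, ∞]`, of the
achievable rates (it is `0` if there are none). -/
def capacity {Ω : Type*} [MeasurableSpace Ω] (σ A : ℝ) (P : Measure Ω) (h : Ω → ℝ)
    (η : ℝ) : ℝ≥0∞ :=
  ⨆ (R : ℝ) (_ : IsAchievable σ A P h η R), ENNReal.ofReal R

end SlowFading

end

/-!
If `h = 0` the output is pure noise, so the probabilities of rejecting `j` when `j` is sent and of
accepting `j` when `i` is sent sum to one, and a reliable code with two codewords is impossible as
soon as `0` must belong to `H₀`.

For the upper bound, `f(y - a)² = exp (‖a - b‖² / σ²) f(y - b) f(y - (2a - b))` and Cauchy–Schwarz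
compare the Gaussian measures of a region under two inputs. Since `H₀` contains some `x` with
`|x| ≤ K`, the codewords of a reliable code are at distance at least a constant independent of `n`,
and a ball of radius `√(nA)` contains only `n ^ (n / 2 + o(n))` such points.

For the lower bound, take codewords at mutual distance `n ^ s`, `s > 1 / 4`; a packing of the ball
of radius `√(nA)` provides `n ^ (n (1 / 2 - s) - o(n))` of them. If `y = h u + z`, then
`‖y - h u‖²` concentrates at `σ² n` within `O(√n)`, while replacing `u` by another codeword adds at
least `|h|² n ^ (2 s) ≫ √n`, so comparing `‖y - h u‖²` with `σ² (n + T √n)` identifies `u`. Both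
errors follow from Chernoff bounds with exponents `± 1 / (σ² √n)`.
-/

open scoped NNReal

namespace SlowFading

section Packing

open Metric Module

lemma natCast_le_packingNumber_iff {X : Type*} [PseudoMetricSpace X] {ε : ℝ≥0} {s : Set X}
    {M : ℕ} :
    (M : ℕ∞) ≤ packingNumber ε s ↔
      ∃ u : Fin M → X, (∀ i, u i ∈ s) ∧ Pairwise fun i j => (ε : ℝ) < dist (u i) (u j) := by
  have lt_edist_iff (x y : X) : (ε : ℝ≥0∞) < edist x y ↔ (ε : ℝ) < dist x y := by
    rw [edist_nndist, ENNReal.coe_lt_coe, ← coe_nndist, NNReal.coe_lt_coe]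
  constructor
  · intro hM
    obtain ⟨C, hCs, hC, hMC⟩ : ∃ C ⊆ s, IsSeparated ε C ∧ (M : ℕ∞) ≤ C.encard := by
      cases M with
      | zero => exact ⟨∅, Set.empty_subset s, .empty, by simp⟩
      | succ k =>
        have hk : (k : ℕ∞) < packingNumber ε s :=
          lt_of_lt_of_le (by exact_mod_cast k.lt_succ_self) hM
        simp only [packingNumber, lt_iSup_iff] at hk
        obtain ⟨C, hCs, hC, hkC⟩ := hk
        exact ⟨C, hCs, hC, by simpa using Order.add_one_le_of_lt hkC⟩
    obtain ⟨N, hNC, hN⟩ := Set.exists_subset_encard_eq hMC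
    have : Finite N := (Set.finite_of_encard_eq_coe hN).to_subtype
    have hcard : Nat.card N = M := by simp [Nat.card_coe_set_eq, Set.ncard, hN]
    let e : Fin M ≃ N := (Finite.equivFinOfCardEq hcard).symm
    exact ⟨fun i => e i, fun i => hCs (hNC (e i).2), fun i j hij => (lt_edist_iff _ _).1 <|
      hC (hNC (e i).2) (hNC (e j).2) fun h => hij (e.injective (Subtype.ext h))⟩
  · rintro ⟨u, hus, hu⟩
    have hinj : Function.Injective u := fun i j hij => by
      by_contra hne
      exact absurd (hu hne) (by simp [hij])
    have hsep : IsSeparated ε (Set.range u) := by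
      rintro _ ⟨i, rfl⟩ _ ⟨j, rfl⟩ hij
      exact (lt_edist_iff _ _).2 (hu fun h => hij (by rw [h]))
    calc (M : ℕ∞) = ENat.card (Fin M) := by simp
      _ ≤ (Set.range u).encard := hinj.encard_range
      _ ≤ packingNumber ε s := hsep.encard_le_packingNumber (Set.range_subset_iff.2 hus)

variable {E : Type*} [NormedAddCommGroup E] [NormedSpace ℝ E] [FiniteDimensional ℝ E]
  {r : ℝ} {ε : ℝ≥0}

lemma div_pow_finrank_le_coveringNumber_closedBall (x : E) (hr : 0 ≤ r) (hε : 0 < ε) :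
    ENNReal.ofReal ((r / ε) ^ finrank ℝ E) ≤ (coveringNumber ε (closedBall x r) : ℝ≥0∞) := by
  borelize E
  let μ : Measure E := Measure.addHaar
  by_cases! htop : coveringNumber ε (closedBall x r) = ⊤
  · simp [htop]
  obtain ⟨C, -, hCfin, hC, hcard⟩ := exists_set_encard_eq_coveringNumber htop
  have hε' : (0 : ℝ) < ε := hε
  have hvol : ENNReal.ofReal (r ^ finrank ℝ E) * μ (ball 0 1) ≤
      C.encard * ENNReal.ofReal (ε ^ finrank ℝ E) * μ (ball 0 1) :=
    calc ENNReal.ofReal (r ^ finrank ℝ E) * μ (ball 0 1)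
        = μ (closedBall x r) := (μ.addHaar_closedBall x hr).symm
      _ ≤ μ (⋃ y ∈ C, closedBall y ε) := measure_mono (isCover_iff_subset_iUnion_closedBall.1 hC)
      _ ≤ ∑' y : C, μ (closedBall (y : E) ε) := measure_biUnion_le μ hCfin.countable _
      _ = C.encard * ENNReal.ofReal (ε ^ finrank ℝ E) * μ (ball 0 1) := by
        simp only [μ.addHaar_closedBall _ hε'.le, ENNReal.tsum_set_const, mul_assoc]
  rw [ENNReal.mul_le_mul_iff_left (measure_ball_pos μ _ one_pos).ne' measure_ball_lt_top.ne] at hvol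
  rwa [← hcard, div_pow, ENNReal.ofReal_div_of_pos (by positivity),
    ENNReal.div_le_iff (by positivity) ENNReal.ofReal_ne_top]

lemma div_pow_finrank_le_packingNumber_closedBall (x : E) (hr : 0 ≤ r) (hε : 0 < ε) :
    ENNReal.ofReal ((r / ε) ^ finrank ℝ E) ≤ (packingNumber ε (closedBall x r) : ℝ≥0∞) :=
  (div_pow_finrank_le_coveringNumber_closedBall x hr hε).trans
    (ENat.toENNReal_le.2 (coveringNumber_le_packingNumber ε _))

lemma pairwiseDisjoint_ball_of_isSeparated {X : Type*} [PseudoMetricSpace X] {C : Set X}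
    (hC : IsSeparated ε C) : C.PairwiseDisjoint fun y => ball y (ε / 2 : ℝ) := by
  intro y hy z hz hyz
  refine ball_disjoint_ball ?_
  have hlt : (ε : ℝ≥0∞) < edist y z := hC hy hz hyz
  rw [edist_nndist, ENNReal.coe_lt_coe] at hlt
  rw [add_halves]
  exact_mod_cast hlt.le

lemma packingNumber_closedBall_le (x : E) (hr : 0 ≤ r) (hε : 0 < ε) :
    (packingNumber ε (closedBall x r) : ℝ≥0∞) ≤
      ENNReal.ofReal ((1 + 2 * r / ε) ^ finrank ℝ E) := by
  borelize E
  let μ : Measure E := Measure.addHaar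
  have hε' : (0 : ℝ) < ε := hε
  simp only [packingNumber, ENat.toENNReal_iSup, iSup_le_iff]
  intro C hCball hC
  have hsub : ⋃ y : C, ball (y : E) (ε / 2) ⊆ ball x (r + ε / 2) :=
    Set.iUnion_subset fun y => ball_subset_ball' <| by linarith [mem_closedBall.1 (hCball y.2)]
  have hvol : C.encard * ENNReal.ofReal ((ε / 2) ^ finrank ℝ E) * μ (ball 0 1) ≤
      ENNReal.ofReal ((r + ε / 2) ^ finrank ℝ E) * μ (ball 0 1) :=
    calc C.encard * ENNReal.ofReal ((ε / 2) ^ finrank ℝ E) * μ (ball 0 1)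
        = ∑' y : C, μ (ball (y : E) (ε / 2)) := by
          simp only [μ.addHaar_ball_of_pos _ (half_pos hε'), ENNReal.tsum_set_const, mul_assoc]
      _ ≤ μ (⋃ y : C, ball (y : E) (ε / 2)) :=
        tsum_meas_le_meas_iUnion_of_disjoint μ (fun _ => measurableSet_ball)
          fun y z hyz => pairwiseDisjoint_ball_of_isSeparated hC y.2 z.2 (Subtype.coe_ne_coe.2 hyz)
      _ ≤ μ (ball x (r + ε / 2)) := measure_mono hsub
      _ = ENNReal.ofReal ((r + ε / 2) ^ finrank ℝ E) * μ (ball 0 1) :=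
        μ.addHaar_ball_of_pos x (by positivity)
  rw [ENNReal.mul_le_mul_iff_left (measure_ball_pos μ _ one_pos).ne' measure_ball_lt_top.ne,
    ← ENNReal.le_div_iff_mul_le (by left; positivity) (by simp),
    ← ENNReal.ofReal_div_of_pos (by positivity), ← div_pow] at hvol
  refine hvol.trans_eq ?_
  congr 2
  field_simp
  ring

lemma exists_pairwise_lt_dist_of_le_div_pow (x : E) {M : ℕ} {d : ℝ} (hr : 0 ≤ r) (hd : 0 < d)
    (hM : (M : ℝ) ≤ (r / d) ^ finrank ℝ E) :
    ∃ u : Fin M → E, (∀ i, u i ∈ closedBall x r) ∧ Pairwise fun i j => d < dist (u i) (u j) := by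
  lift d to ℝ≥0 using hd.le
  rw [← natCast_le_packingNumber_iff, ← ENat.toENNReal_le, ENat.toENNReal_coe,
    ← ENNReal.ofReal_natCast]
  exact (ENNReal.ofReal_le_ofReal hM).trans (div_pow_finrank_le_packingNumber_closedBall x hr hd)

lemma le_pow_of_pairwise_lt_dist {x : E} {M : ℕ} {d : ℝ} (hr : 0 ≤ r) (hd : 0 < d) {u : Fin M → E}
    (hu : ∀ i, u i ∈ closedBall x r) (hsep : Pairwise fun i j => d < dist (u i) (u j)) :
    (M : ℝ) ≤ (1 + 2 * r / d) ^ finrank ℝ E := by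
  lift d to ℝ≥0 using hd.le
  have hM := natCast_le_packingNumber_iff.2 ⟨u, hu, hsep⟩
  rw [← ENat.toENNReal_le, ENat.toENNReal_coe, ← ENNReal.ofReal_natCast] at hM
  exact (ENNReal.ofReal_le_ofReal_iff (by positivity)).1
    (hM.trans (packingNumber_closedBall_le x hr hd))

end Packing

section Integral

variable {α : Type*} [MeasurableSpace α] {μ : Measure α}

lemma sq_integral_le_integral_mul_integral {f g k : α → ℝ} (hf : Integrable f μ)
    (hg : Integrable g μ) (hk : Integrable k μ) (hg0 : 0 ≤ g) (hk0 : 0 ≤ k)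
    (hfgk : ∀ x, f x ^ 2 ≤ g x * k x) :
    (∫ x, f x ∂μ) ^ 2 ≤ (∫ x, g x ∂μ) * ∫ x, k x ∂μ := by
  have pointwise (t : ℝ) (x : α) : 2 * t * f x ≤ t ^ 2 * g x + k x := by
    refine le_of_sq_le_sq ?_ (add_nonneg (mul_nonneg (sq_nonneg t) (hg0 x)) (hk0 x))
    nlinarith [sq_nonneg (t ^ 2 * g x - k x), mul_le_mul_of_nonneg_left (hfgk x) (sq_nonneg t)]
  have quadratic_nonneg (t : ℝ) :
      0 ≤ (∫ x, g x ∂μ) * (t * t) + -(2 * ∫ x, f x ∂μ) * t + ∫ x, k x ∂μ := by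
    have h := integral_mono (hf.const_mul (2 * t)) ((hg.const_mul (t ^ 2)).add hk) (pointwise t)
    simp only [Pi.add_apply] at h
    rw [integral_const_mul, integral_add (hg.const_mul _) hk, integral_const_mul] at h
    linarith
  have h := discrim_le_zero quadratic_nonneg
  rw [discrim] at h
  linarith

lemma setIntegral_le_exp_neg_mul_integral {f g : α → ℝ} {D : Set α} {τ : ℝ} (hf0 : 0 ≤ f)
    (hfg : Integrable (fun x => f x * Real.exp (g x)) μ) (hD : MeasurableSet D)
    (hg : ∀ x ∈ D, τ ≤ g x) :
    ∫ x in D, f x ∂μ ≤ Real.exp (-τ) * ∫ x, f x * Real.exp (g x) ∂μ := by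
  have hfg0 (x : α) : 0 ≤ f x * Real.exp (g x) := mul_nonneg (hf0 x) (Real.exp_pos _).le
  calc ∫ x in D, f x ∂μ ≤ ∫ x in D, Real.exp (-τ) * (f x * Real.exp (g x)) ∂μ := by
        refine integral_mono_of_nonneg (.of_forall hf0) (hfg.const_mul _).integrableOn ?_
        filter_upwards [ae_restrict_mem hD] with x hx
        rw [mul_left_comm, ← Real.exp_add]
        exact le_mul_of_one_le_right (hf0 x) (Real.one_le_exp (by linarith [hg x hx]))
    _ = Real.exp (-τ) * ∫ x in D, f x * Real.exp (g x) ∂μ := integral_const_mul _ _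
    _ ≤ Real.exp (-τ) * ∫ x, f x * Real.exp (g x) ∂μ :=
        mul_le_mul_of_nonneg_left (setIntegral_le_integral hfg (.of_forall hfg0))
          (Real.exp_pos _).le

lemma exists_lt_measureReal_of_monotone [IsFiniteMeasure μ] {s : ℕ → Set α} (hs : Monotone s)
    {c : ℝ} (hc : c < μ.real (⋃ k, s k)) : ∃ k, c < μ.real (s k) :=
  (((ENNReal.tendsto_toReal (measure_ne_top μ _)).comp
    (tendsto_measure_iUnion_atTop hs)).eventually (lt_mem_nhds hc)).exists

lemma exists_and_of_one_lt_measureReal_add [IsProbabilityMeasure μ] {β : Type*}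
    [MeasurableSpace β] {f : α → β} (hf : Measurable f) {p q : β → Prop}
    (hq : MeasurableSet {y | q y}) (hpq : 1 < μ.real {x | p (f x)} + μ.real {x | q (f x)}) :
    ∃ y, p y ∧ q y := by
  obtain ⟨x, hpx, hqx⟩ := nonempty_inter_of_measureReal_lt_add (hf hq) (Set.subset_univ _)
    (Set.subset_univ _) (probReal_univ.trans_lt hpq)
  exact ⟨f x, hpx, hqx⟩

end Integral

section Noise

variable {σ : ℝ} {n : ℕ}

lemma noiseDensity_nonneg (σ : ℝ) (n : ℕ) (z : EuclideanSpace ℝ (Fin n)) :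
    0 ≤ noiseDensity σ n z := by
  unfold noiseDensity
  positivity

lemma integral_noiseDensity (hσ : 0 < σ) (n : ℕ) : ∫ z, noiseDensity σ n z = 1 := by
  have hexp (z : EuclideanSpace ℝ (Fin n)) :
      -‖z‖ ^ 2 / (2 * σ ^ 2) = -(1 / (2 * σ ^ 2)) * ‖z‖ ^ 2 := by ring
  have hnorm : 0 < (2 * Real.pi * σ ^ 2) ^ ((n : ℝ) / 2) := by positivity
  simp only [noiseDensity, hexp]
  rw [integral_const_mul, GaussianFourier.integral_rexp_neg_mul_sq_norm (by positivity),
    finrank_euclideanSpace_fin,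
    show Real.pi / (1 / (2 * σ ^ 2)) = 2 * Real.pi * σ ^ 2 by field_simp]
  exact one_div_mul_cancel hnorm.ne'

lemma integral_noiseDensity_sub (hσ : 0 < σ) (a : EuclideanSpace ℝ (Fin n)) :
    ∫ y, noiseDensity σ n (y - a) = 1 := by
  rw [integral_sub_right_eq_self (noiseDensity σ n) a, integral_noiseDensity hσ]

lemma integrable_noiseDensity_sub (hσ : 0 < σ) (a : EuclideanSpace ℝ (Fin n)) :
    Integrable fun y => noiseDensity σ n (y - a) :=
  .of_integral_ne_zero (by simp [integral_noiseDensity_sub hσ])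

lemma setIntegral_noiseDensity_sub_le_one (hσ : 0 < σ) (a : EuclideanSpace ℝ (Fin n))
    (D : Set (EuclideanSpace ℝ (Fin n))) : ∫ y in D, noiseDensity σ n (y - a) ≤ 1 :=
  (setIntegral_le_integral (integrable_noiseDensity_sub hσ a)
    (.of_forall fun _ => noiseDensity_nonneg _ _ _)).trans_eq (integral_noiseDensity_sub hσ a)

lemma noiseDensity_sub_sq (a b y : EuclideanSpace ℝ (Fin n)) :
    noiseDensity σ n (y - a) ^ 2 =
      Real.exp (‖a - b‖ ^ 2 / σ ^ 2) * noiseDensity σ n (y - b) *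
        noiseDensity σ n (y - (2 • a - b)) := by
  have hpar : ‖y - b‖ ^ 2 + ‖y - (2 • a - b)‖ ^ 2 = 2 * (‖y - a‖ ^ 2 + ‖a - b‖ ^ 2) := by
    rw [← parallelogram_law_with_norm ℝ (y - a) (a - b)]
    congr 3 <;> abel
  have hexp : -‖y - a‖ ^ 2 / (2 * σ ^ 2) + -‖y - a‖ ^ 2 / (2 * σ ^ 2) =
      ‖a - b‖ ^ 2 / σ ^ 2 + -‖y - b‖ ^ 2 / (2 * σ ^ 2) +
        -‖y - (2 • a - b)‖ ^ 2 / (2 * σ ^ 2) := by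
    linear_combination hpar / (2 * σ ^ 2)
  have h := congrArg Real.exp hexp
  simp only [Real.exp_add] at h
  unfold noiseDensity
  linear_combination (1 / (2 * Real.pi * σ ^ 2) ^ ((n : ℝ) / 2)) ^ 2 * h

lemma sq_setIntegral_noiseDensity_sub_le (hσ : 0 < σ) (a b : EuclideanSpace ℝ (Fin n))
    (D : Set (EuclideanSpace ℝ (Fin n))) :
    (∫ y in D, noiseDensity σ n (y - a)) ^ 2 ≤
      Real.exp (‖a - b‖ ^ 2 / σ ^ 2) * ∫ y in D, noiseDensity σ n (y - b) := by
  have hint (c : EuclideanSpace ℝ (Fin n)) : IntegrableOn (fun y => noiseDensity σ n (y - c)) D :=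
    (integrable_noiseDensity_sub hσ c).integrableOn
  have hb0 (y : EuclideanSpace ℝ (Fin n)) :
      0 ≤ Real.exp (‖a - b‖ ^ 2 / σ ^ 2) * noiseDensity σ n (y - b) :=
    mul_nonneg (Real.exp_pos _).le (noiseDensity_nonneg _ _ _)
  have hCS := sq_integral_le_integral_mul_integral (hint a) ((hint b).const_mul _)
    (hint (2 • a - b)) hb0 (fun _ => noiseDensity_nonneg _ _ _)
    fun y => (noiseDensity_sub_sq a b y).le
  rw [integral_const_mul] at hCS
  refine hCS.trans (mul_le_of_le_one_right ?_ (setIntegral_noiseDensity_sub_le_one hσ _ D))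
  rw [← integral_const_mul]
  exact integral_nonneg hb0

lemma neg_norm_sub_sq_div_add_mul_norm_sub_sq (hσ : σ ≠ 0) {s : ℝ} (hs : 1 - 2 * s * σ ^ 2 ≠ 0)
    (a b y : EuclideanSpace ℝ (Fin n)) :
    -‖y - a‖ ^ 2 / (2 * σ ^ 2) + s * ‖y - b‖ ^ 2 =
      s * ‖a - b‖ ^ 2 / (1 - 2 * s * σ ^ 2) +
        -‖y - (b + (1 - 2 * s * σ ^ 2)⁻¹ • (a - b))‖ ^ 2 /
          (2 * (σ ^ 2 / (1 - 2 * s * σ ^ 2))) := by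
  have ha : y - a = (y - b) - (a - b) := by abel
  rw [← sub_sub y b, ha, norm_sub_sq_real, norm_sub_sq_real (y - b) (_ • (a - b)), norm_smul,
    real_inner_smul_right, mul_pow, Real.norm_eq_abs, sq_abs]
  obtain ⟨t, ht⟩ : ∃ t, t = 1 - 2 * s * σ ^ 2 := ⟨_, rfl⟩
  obtain rfl : s = (1 - t) / (2 * σ ^ 2) := by
    rw [ht]
    field_simp
    ring
  rw [← ht] at hs ⊢
  field_simp
  ring

/- Completing the square turns the tilted Gaussian into a Gaussian of variance
`σ² / (1 - 2 s σ²)`. -/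
lemma noiseDensity_sub_mul_exp (hσ : 0 < σ) {s : ℝ} (hs : 0 < 1 - 2 * s * σ ^ 2)
    (a b y : EuclideanSpace ℝ (Fin n)) :
    noiseDensity σ n (y - a) * Real.exp (s * ‖y - b‖ ^ 2) =
      (1 - 2 * s * σ ^ 2) ^ (-((n : ℝ) / 2)) *
        Real.exp (s * ‖a - b‖ ^ 2 / (1 - 2 * s * σ ^ 2)) *
        noiseDensity (σ / √(1 - 2 * s * σ ^ 2)) n
          (y - (b + (1 - 2 * s * σ ^ 2)⁻¹ • (a - b))) := by
  have hexp := neg_norm_sub_sq_div_add_mul_norm_sub_sq hσ.ne' hs.ne' a b y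
  set t := 1 - 2 * s * σ ^ 2
  have hvar : (σ / √t) ^ 2 = σ ^ 2 / t := by rw [div_pow, Real.sq_sqrt hs.le]
  have hnorm : (2 * Real.pi * (σ ^ 2 / t)) ^ ((n : ℝ) / 2) =
      (2 * Real.pi * σ ^ 2) ^ ((n : ℝ) / 2) / t ^ ((n : ℝ) / 2) := by
    rw [← mul_div_assoc, Real.div_rpow (by positivity) hs.le]
  unfold noiseDensity
  rw [hvar, hnorm, mul_assoc, ← Real.exp_add, hexp, Real.exp_add, Real.rpow_neg hs.le]
  have : 0 < t ^ ((n : ℝ) / 2) := by positivity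
  field_simp

lemma integrable_noiseDensity_sub_mul_exp (hσ : 0 < σ) {s : ℝ} (hs : 0 < 1 - 2 * s * σ ^ 2)
    (a b : EuclideanSpace ℝ (Fin n)) :
    Integrable fun y => noiseDensity σ n (y - a) * Real.exp (s * ‖y - b‖ ^ 2) := by
  simp only [noiseDensity_sub_mul_exp hσ hs]
  exact (integrable_noiseDensity_sub (by positivity) _).const_mul _

lemma integral_noiseDensity_sub_mul_exp (hσ : 0 < σ) {s : ℝ} (hs : 0 < 1 - 2 * s * σ ^ 2)
    (a b : EuclideanSpace ℝ (Fin n)) :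
    ∫ y, noiseDensity σ n (y - a) * Real.exp (s * ‖y - b‖ ^ 2) =
      (1 - 2 * s * σ ^ 2) ^ (-((n : ℝ) / 2)) *
        Real.exp (s * ‖a - b‖ ^ 2 / (1 - 2 * s * σ ^ 2)) := by
  simp only [noiseDensity_sub_mul_exp hσ hs]
  rw [integral_const_mul, integral_noiseDensity_sub (by positivity), mul_one]

lemma rpow_neg_le_exp_mul {t p : ℝ} (ht : 0 < t) (hp : 0 ≤ p) :
    t ^ (-p) ≤ Real.exp (p * (t⁻¹ - 1)) := by
  rw [Real.rpow_def_of_pos ht, Real.exp_le_exp]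
  nlinarith [mul_le_mul_of_nonneg_left (Real.one_sub_inv_le_log_of_pos ht) hp]

lemma setIntegral_noiseDensity_sub_le_exp (hσ : 0 < σ) {s τ : ℝ} (hs : 0 < 1 - 2 * s * σ ^ 2)
    (a b : EuclideanSpace ℝ (Fin n)) {D : Set (EuclideanSpace ℝ (Fin n))} (hD : MeasurableSet D)
    (hτ : ∀ y ∈ D, τ ≤ s * ‖y - b‖ ^ 2) :
    ∫ y in D, noiseDensity σ n (y - a) ≤
      Real.exp (-τ + (n : ℝ) / 2 * ((1 - 2 * s * σ ^ 2)⁻¹ - 1) +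
        s * ‖a - b‖ ^ 2 / (1 - 2 * s * σ ^ 2)) := by
  rw [Real.exp_add, Real.exp_add, mul_assoc]
  refine (setIntegral_le_exp_neg_mul_integral (fun _ => noiseDensity_nonneg _ _ _)
    (integrable_noiseDensity_sub_mul_exp hσ hs a b) hD hτ).trans ?_
  rw [integral_noiseDensity_sub_mul_exp hσ hs]
  gcongr
  exact rpow_neg_le_exp_mul hs (by positivity)

end Noise

section Typicality

variable {σ : ℝ} {n : ℕ}

/-- The outputs that are typical for the faded codeword `a`. The noise has `E ‖z‖² = n σ²`, and
`‖z‖²` has standard deviation `σ² √(2n)`, so `T` measures the deviation on the natural scale. -/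
def typicalBall (σ : ℝ) (n : ℕ) (T : ℝ) (a : EuclideanSpace ℝ (Fin n)) :
    Set (EuclideanSpace ℝ (Fin n)) :=
  {y | ‖y - a‖ ^ 2 ≤ σ ^ 2 * (n + T * √n)}

lemma measurableSet_typicalBall (σ T : ℝ) (a : EuclideanSpace ℝ (Fin n)) :
    MeasurableSet (typicalBall σ n T a) :=
  (isClosed_le (by fun_prop) continuous_const).measurableSet

lemma mem_typicalBall_iff (hσ : 0 < σ) (hn : 0 < n) {T : ℝ} {a y : EuclideanSpace ℝ (Fin n)} :
    y ∈ typicalBall σ n T a ↔ (σ ^ 2 * √n)⁻¹ * ‖y - a‖ ^ 2 ≤ √n + T := by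
  have : (0 : ℝ) < √n := by positivity
  have hn' : σ ^ 2 * (n + T * √n) = σ ^ 2 * √n * (√n + T) := by
    linear_combination -σ ^ 2 * Real.mul_self_sqrt n.cast_nonneg
  rw [inv_mul_le_iff₀ (by positivity), ← hn']
  exact Iff.rfl

lemma setIntegral_compl_typicalBall_le (hσ : 0 < σ) (hn : 16 ≤ n) (T : ℝ)
    (a : EuclideanSpace ℝ (Fin n)) :
    ∫ y in (typicalBall σ n T a)ᶜ, noiseDensity σ n (y - a) ≤ Real.exp (4 - T) := by
  have hn0 : 0 < n := by omega
  have hq : 4 ≤ √(n : ℝ) := Real.le_sqrt_of_sq_le (by norm_num; exact_mod_cast hn)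
  have hq2 : 0 < √(n : ℝ) - 2 := by linarith
  have htilt : 1 - 2 * (σ ^ 2 * √n)⁻¹ * σ ^ 2 = (√n - 2) / √n := by field_simp
  have hnormalizer : (n : ℝ) / 2 * (((√n - 2) / √n)⁻¹ - 1) ≤ √n + 4 := by
    rw [inv_div, div_sub_one hq2.ne', div_mul_div_comm, div_le_iff₀ (by positivity)]
    nlinarith [Real.mul_self_sqrt (n.cast_nonneg (α := ℝ))]
  refine (setIntegral_noiseDensity_sub_le_exp hσ (s := (σ ^ 2 * √n)⁻¹) (τ := √n + T)
    (by rw [htilt]; positivity) a a (measurableSet_typicalBall σ T a).compl fun y hy => ?_).trans ?_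
  · exact (not_le.1 ((mem_typicalBall_iff hσ hn0).not.1 hy)).le
  · rw [htilt, sub_self, norm_zero, zero_pow two_ne_zero, mul_zero, zero_div, Real.exp_le_exp]
    linarith

lemma setIntegral_typicalBall_le (hσ : 0 < σ) (hn : 0 < n) (T : ℝ)
    (a b : EuclideanSpace ℝ (Fin n)) :
    ∫ y in typicalBall σ n T b, noiseDensity σ n (y - a) ≤
      Real.exp (T + 2 - ‖a - b‖ ^ 2 / (σ ^ 2 * (√n + 2))) := by
  have : 0 < √(n : ℝ) := by positivity
  have htilt : 1 - 2 * -(σ ^ 2 * √n)⁻¹ * σ ^ 2 = (√n + 2) / √n := by field_simp; ring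
  have hnormalizer : (n : ℝ) / 2 * (((√n + 2) / √n)⁻¹ - 1) ≤ -√n + 2 := by
    rw [inv_div, div_sub_one (by positivity), div_mul_div_comm, div_le_iff₀ (by positivity)]
    nlinarith [Real.mul_self_sqrt (n.cast_nonneg (α := ℝ))]
  have hshift : -(σ ^ 2 * √n)⁻¹ * ‖a - b‖ ^ 2 / ((√n + 2) / √n) =
      -(‖a - b‖ ^ 2 / (σ ^ 2 * (√n + 2))) := by field_simp
  refine (setIntegral_noiseDensity_sub_le_exp hσ (s := -(σ ^ 2 * √n)⁻¹) (τ := -(√n + T))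
    (by rw [htilt]; positivity) a b (measurableSet_typicalBall σ T b) fun y hy => ?_).trans ?_
  · rw [neg_mul, neg_le_neg_iff]
    exact (mem_typicalBall_iff hσ hn).1 hy
  · rw [htilt, hshift, Real.exp_le_exp]
    linarith

end Typicality

section Code

variable {Ω : Type*} [MeasurableSpace Ω] {P : Measure Ω} {h : Ω → ℝ} {σ A η lam₁ lam₂ : ℝ}
  {M n : ℕ}

namespace DICode

lemma one_sub_errorI (hσ : 0 < σ) (𝒞 : DICode M n A) (i : Fin M) (x : ℝ) :
    1 - 𝒞.errorI σ i x = ∫ y in 𝒞.region i x, noiseDensity σ n (y - x • 𝒞.codeword i) := by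
  rw [errorI, ← integral_noiseDensity_sub hσ (x • 𝒞.codeword i), sub_eq_iff_eq_add,
    integral_add_compl (𝒞.measurableSet_region i x) (integrable_noiseDensity_sub hσ _)]

lemma errorII_zero (hσ : 0 < σ) (𝒞 : DICode M n A) (i j : Fin M) :
    𝒞.errorII σ i j 0 = 1 - 𝒞.errorI σ j 0 := by
  rw [one_sub_errorI hσ, errorII, zero_smul, zero_smul]

lemma errorII_nonneg (𝒞 : DICode M n A) (σ : ℝ) (i j : Fin M) (x : ℝ) : 0 ≤ 𝒞.errorII σ i j x :=
  integral_nonneg fun _ => noiseDensity_nonneg _ _ _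

lemma sq_one_sub_errorI_le (hσ : 0 < σ) (𝒞 : DICode M n A) (i j : Fin M) (x : ℝ) :
    (1 - 𝒞.errorI σ i x) ^ 2 ≤
      Real.exp ((|x| * dist (𝒞.codeword i) (𝒞.codeword j) / σ) ^ 2) * 𝒞.errorII σ j i x := by
  rw [one_sub_errorI hσ, errorII, div_pow, ← Real.norm_eq_abs, ← dist_smul₀, dist_eq_norm]
  exact sq_setIntegral_noiseDensity_sub_le hσ _ _ _

/-- The code that accepts the identity `i` when the output is typical for the faded codeword
`x • u i`. -/
def ofTypicalBall (σ T : ℝ) (u : Fin M → EuclideanSpace ℝ (Fin n)) (hu : ∀ i, ‖u i‖ ^ 2 ≤ n * A) :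
    DICode M n A where
  codeword := u
  region i x := typicalBall σ n T (x • u i)
  norm_sq_le := hu
  measurableSet_region i x := measurableSet_typicalBall σ T (x • u i)

lemma IsReliable.lt_dist_codeword [IsProbabilityMeasure P] (hh : Measurable h) (hσ : 0 < σ)
    {K d : ℝ} {𝒞 : DICode M n A} (h𝒞 : 𝒞.IsReliable σ P h lam₁ lam₂ η)
    (hK : η < P.real {ω | |h ω| ≤ K}) (hlam₁ : lam₁ ≤ 1)
    (hd : Real.exp ((K * d / σ) ^ 2) * lam₂ < (1 - lam₁) ^ 2) {i j : Fin M} (hij : i ≠ j) :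
    d < dist (𝒞.codeword i) (𝒞.codeword j) := by
  obtain ⟨H₀, hH₀, hP, hI, hII⟩ := h𝒞
  obtain ⟨x, hxK, hx⟩ := exists_and_of_one_lt_measureReal_add (p := (|·| ≤ K)) hh hH₀
    (by linarith : 1 < P.real {ω | |h ω| ≤ K} + P.real {ω | h ω ∈ H₀})
  by_contra! hle
  have hlt : (1 - 𝒞.errorI σ i x) ^ 2 < (1 - lam₁) ^ 2 := by
    calc (1 - 𝒞.errorI σ i x) ^ 2
        ≤ Real.exp ((|x| * dist (𝒞.codeword i) (𝒞.codeword j) / σ) ^ 2) * 𝒞.errorII σ j i x :=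
          sq_one_sub_errorI_le hσ 𝒞 i j x
      _ ≤ Real.exp ((K * d / σ) ^ 2) * lam₂ := by
          have hK0 : 0 ≤ K := (abs_nonneg x).trans hxK
          have hII0 := 𝒞.errorII_nonneg σ j i x
          gcongr
          exact hII j i hij.symm x hx
      _ < (1 - lam₁) ^ 2 := hd
  exact hlt.not_ge (pow_le_pow_left₀ (sub_nonneg.2 hlam₁) (sub_le_sub_left (hI i x hx) 1) 2)

end DICode

namespace ExistsDICode

lemma card_le_one [IsProbabilityMeasure P] (hh : Measurable h) (hσ : 0 < σ)
    (hη : η < P.real {ω | h ω = 0}) (hlam : lam₁ + lam₂ < 1)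
    (hM : ExistsDICode σ A P h M n lam₁ lam₂ η) : M ≤ 1 := by
  obtain ⟨𝒞, H₀, hH₀, hP, hI, hII⟩ := hM
  obtain ⟨_, rfl, h0⟩ := exists_and_of_one_lt_measureReal_add (p := (· = 0)) hh hH₀
    (by linarith : 1 < P.real {ω | h ω = 0} + P.real {ω | h ω ∈ H₀})
  by_contra! hM
  let i : Fin M := ⟨0, by omega⟩
  let j : Fin M := ⟨1, hM⟩
  have hij : i ≠ j := by simp [i, j]
  linarith [hI j 0 h0, hII i j hij 0 h0, 𝒞.errorII_zero hσ i j]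

lemma card_le [IsProbabilityMeasure P] (hh : Measurable h) (hσ : 0 < σ) {K d : ℝ}
    (hM : ExistsDICode σ A P h M n lam₁ lam₂ η) (hK : η < P.real {ω | |h ω| ≤ K}) (hd0 : 0 < d)
    (hlam₁ : lam₁ ≤ 1) (hd : Real.exp ((K * d / σ) ^ 2) * lam₂ < (1 - lam₁) ^ 2) :
    (M : ℝ) ≤ (1 + 2 * √(n * A) / d) ^ n := by
  obtain ⟨𝒞, h𝒞⟩ := hM
  have hball (i : Fin M) : 𝒞.codeword i ∈ Metric.closedBall 0 √(n * A) :=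
    mem_closedBall_zero_iff.2 (Real.le_sqrt_of_sq_le (𝒞.norm_sq_le i))
  simpa only [finrank_euclideanSpace_fin] using le_pow_of_pairwise_lt_dist (Real.sqrt_nonneg _) hd0
    hball fun i j hij => h𝒞.lt_dist_codeword hh hσ hK hlam₁ hd hij

lemma of_card_le (hσ : 0 < σ) (hA : 0 ≤ A) {γ d : ℝ} (hγ0 : 0 ≤ γ)
    (hγ : 1 - η ≤ P.real {ω | γ ≤ |h ω|}) (hd : 0 < d) (hn : 16 ≤ n)
    (hM : (M : ℝ) ≤ (√(n * A) / d) ^ n) (T : ℝ) :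
    ExistsDICode σ A P h M n (Real.exp (4 - T))
      (Real.exp (T + 2 - (γ * d) ^ 2 / (σ ^ 2 * (√n + 2)))) η := by
  obtain ⟨u, hball, hsep⟩ := exists_pairwise_lt_dist_of_le_div_pow
    (0 : EuclideanSpace ℝ (Fin n)) (Real.sqrt_nonneg (n * A)) hd
    (by rwa [finrank_euclideanSpace_fin])
  have hu (i : Fin M) : ‖u i‖ ^ 2 ≤ n * A :=
    (Real.le_sqrt (norm_nonneg _) (by positivity)).1 (mem_closedBall_zero_iff.1 (hball i))
  refine ⟨.ofTypicalBall σ T u hu, {x | γ ≤ |x|}, measurableSet_le measurable_const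
    measurable_id.abs, hγ, fun i x _ => setIntegral_compl_typicalBall_le hσ hn T _,
    fun i j hij x (hx : γ ≤ |x|) => ?_⟩
  have hdist : γ * d ≤ ‖x • u i - x • u j‖ := by
    rw [← dist_eq_norm, dist_smul₀, Real.norm_eq_abs]
    exact mul_le_mul hx (hsep hij).le hd.le (abs_nonneg x)
  refine (setIntegral_typicalBall_le hσ (by omega) T (x • u i) (x • u j)).trans ?_
  gcongr

lemma mono {lam₁' lam₂' : ℝ} (hM : ExistsDICode σ A P h M n lam₁ lam₂ η) (h₁ : lam₁ ≤ lam₁')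
    (h₂ : lam₂ ≤ lam₂') : ExistsDICode σ A P h M n lam₁' lam₂' η := by
  obtain ⟨𝒞, H₀, hH₀, hP, hI, hII⟩ := hM
  exact ⟨𝒞, H₀, hH₀, hP, fun i x hx => (hI i x hx).trans h₁,
    fun i j hij x hx => (hII i j hij x hx).trans h₂⟩

end ExistsDICode

end Code

section Fading

variable {Ω : Type*} [MeasurableSpace Ω] {P : Measure Ω} [IsProbabilityMeasure P] {h : Ω → ℝ}
  {η : ℝ}

lemma exists_lt_measureReal_abs_le (h : Ω → ℝ) (hη : η < 1) :
    ∃ K : ℝ, 0 < K ∧ η < P.real {ω | |h ω| ≤ K} := by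
  have hmono : Monotone fun k : ℕ => {ω | |h ω| ≤ k + 1} := fun k l hkl ω (hω : |h ω| ≤ k + 1) =>
    show |h ω| ≤ l + 1 from hω.trans (by gcongr)
  have hunion : ⋃ k : ℕ, {ω | |h ω| ≤ k + 1} = Set.univ :=
    Set.eq_univ_of_forall fun ω => by
      obtain ⟨k, hk⟩ := exists_nat_ge |h ω|
      exact Set.mem_iUnion.2 ⟨k, show |h ω| ≤ k + 1 by linarith⟩
  obtain ⟨k, hk⟩ := exists_lt_measureReal_of_monotone (μ := P) hmono
    (by rwa [hunion, probReal_univ])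
  exact ⟨k + 1, by positivity, hk⟩

lemma exists_le_measureReal_le_abs (hh : Measurable h) (hη : P.real {ω | h ω = 0} < η) :
    ∃ γ : ℝ, 0 < γ ∧ 1 - η ≤ P.real {ω | γ ≤ |h ω|} := by
  have hmono : Monotone fun k : ℕ => {ω | 1 / ((k : ℝ) + 1) ≤ |h ω|} :=
    fun k l hkl ω (hω : 1 / ((k : ℝ) + 1) ≤ |h ω|) =>
      show 1 / ((l : ℝ) + 1) ≤ |h ω| from (Nat.one_div_le_one_div hkl).trans hω
  have hsub : {ω | h ω = 0}ᶜ ⊆ ⋃ k : ℕ, {ω | 1 / ((k : ℝ) + 1) ≤ |h ω|} := fun ω hω => by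
    obtain ⟨k, hk⟩ := exists_nat_one_div_lt (abs_pos.2 hω)
    exact Set.mem_iUnion.2 ⟨k, hk.le⟩
  have hcompl : 1 - η < P.real {ω | h ω = 0}ᶜ := by
    rw [probReal_compl_eq_one_sub (measurableSet_eq_fun hh measurable_const)]
    linarith
  obtain ⟨k, hk⟩ := exists_lt_measureReal_of_monotone hmono
    (hcompl.trans_le (measureReal_mono hsub))
  exact ⟨1 / (k + 1), by positivity, hk.le⟩

end Fading

section Asymptotics

lemma tendsto_natCast_rpow_atTop {s : ℝ} (hs : 0 < s) :
    Tendsto (fun n : ℕ => (n : ℝ) ^ s) atTop atTop :=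
  (tendsto_rpow_atTop hs).comp tendsto_natCast_atTop_atTop

lemma eventually_one_add_mul_rpow_pow_lt {c S R : ℝ} (hc : 0 ≤ c) (hS : 0 ≤ S) (hSR : S < R) :
    ∀ᶠ n : ℕ in atTop, (1 + c * (n : ℝ) ^ S) ^ n < (n : ℝ) ^ ((n : ℝ) * R) := by
  filter_upwards [(tendsto_natCast_rpow_atTop (sub_pos.2 hSR)).eventually_gt_atTop (1 + c),
    eventually_ge_atTop 1] with n hlarge hn
  have hn' : (1 : ℝ) ≤ n := by exact_mod_cast hn
  have hbase : 1 + c * (n : ℝ) ^ S < (n : ℝ) ^ R :=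
    calc 1 + c * (n : ℝ) ^ S ≤ (1 + c) * (n : ℝ) ^ S := by
          linarith [Real.one_le_rpow hn' hS]
      _ < (n : ℝ) ^ (R - S) * (n : ℝ) ^ S := by gcongr
      _ = (n : ℝ) ^ R := by rw [← Real.rpow_add (by linarith), sub_add_cancel]
  rw [mul_comm (n : ℝ) R, Real.rpow_mul_natCast n.cast_nonneg]
  exact pow_lt_pow_left₀ hbase (by positivity) (by omega)

lemma eventually_natCeil_rpow_le {c R S : ℝ} (hc : 0 < c) (hR : 0 ≤ R) (hRS : R < S) :
    ∀ᶠ n : ℕ in atTop, (⌈(n : ℝ) ^ ((n : ℝ) * R)⌉₊ : ℝ) ≤ (c * (n : ℝ) ^ S) ^ n := by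
  filter_upwards [(tendsto_natCast_rpow_atTop (sub_pos.2 hRS)).eventually_ge_atTop (2 / c),
    eventually_ge_atTop 1] with n hlarge hn
  have hn' : (1 : ℝ) ≤ n := by exact_mod_cast hn
  have hbase : 2 * (n : ℝ) ^ R ≤ c * (n : ℝ) ^ S :=
    calc 2 * (n : ℝ) ^ R ≤ c * (n : ℝ) ^ (S - R) * (n : ℝ) ^ R := by
          gcongr
          exact (div_le_iff₀' hc).1 hlarge
      _ = c * (n : ℝ) ^ S := by rw [mul_assoc, ← Real.rpow_add (by linarith), sub_add_cancel]
  calc (⌈(n : ℝ) ^ ((n : ℝ) * R)⌉₊ : ℝ) ≤ 2 * (n : ℝ) ^ ((n : ℝ) * R) :=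
        (Nat.ceil_le_two_mul ((Real.one_le_rpow hn' (by positivity)).trans' (by norm_num)))
    _ ≤ 2 ^ n * (n : ℝ) ^ ((n : ℝ) * R) := by
        gcongr
        exact le_self_pow₀ one_le_two (by omega)
    _ = (2 * (n : ℝ) ^ R) ^ n := by
        rw [mul_pow, mul_comm (n : ℝ) R, Real.rpow_mul_natCast n.cast_nonneg]
    _ ≤ (c * (n : ℝ) ^ S) ^ n := by gcongr

lemma tendsto_sq_mul_rpow_div_sqrt_add_atTop {σ γ s : ℝ} (hσ : 0 < σ) (hγ : 0 < γ)
    (hs : 1 / 4 < s) :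
    Tendsto (fun n : ℕ => (γ * (n : ℝ) ^ s) ^ 2 / (σ ^ 2 * (√n + 2))) atTop atTop := by
  have hpos : 0 < 2 * s - 1 / 2 := by linarith
  refine tendsto_atTop_mono' _ ?_ ((tendsto_natCast_rpow_atTop hpos).const_mul_atTop
    (show 0 < γ ^ 2 / (3 * σ ^ 2) by positivity))
  filter_upwards [eventually_ge_atTop 1] with n hn
  have hn' : (1 : ℝ) ≤ n := by exact_mod_cast hn
  have hq : (1 : ℝ) ≤ √n := Real.one_le_sqrt.2 hn'
  calc γ ^ 2 / (3 * σ ^ 2) * (n : ℝ) ^ (2 * s - 1 / 2)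
      = (γ * (n : ℝ) ^ s) ^ 2 / (σ ^ 2 * (3 * √n)) := by
        rw [Real.rpow_sub (by linarith), ← Real.sqrt_eq_rpow, two_mul s,
          Real.rpow_add (by linarith)]
        field_simp
    _ ≤ (γ * (n : ℝ) ^ s) ^ 2 / (σ ^ 2 * (√n + 2)) := by
        gcongr
        linarith

end Asymptotics

section Capacity

variable {Ω : Type*} [MeasurableSpace Ω] {P : Measure Ω} [IsProbabilityMeasure P] {h : Ω → ℝ}
  {σ A η R : ℝ}

lemma not_isAchievable (hh : Measurable h) (hσ : 0 < σ) (hη : η < P.real {ω | h ω = 0}) :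
    ¬ IsAchievable σ A P h η R := by
  rintro ⟨hR, hach⟩
  obtain ⟨n, hcode, hn⟩ := ((hach (1 / 4) (1 / 4) (by norm_num) (by norm_num)).and
    (eventually_ge_atTop 2)).exists
  have hn' : (2 : ℝ) ≤ n := by exact_mod_cast hn
  have hlarge : 1 < (n : ℝ) ^ ((n : ℝ) * R) := Real.one_lt_rpow (by linarith) (by positivity)
  exact (Nat.lt_ceil.2 (by simpa using hlarge)).not_ge (hcode.card_le_one hh hσ hη (by norm_num))

lemma capacity_eq_zero (hh : Measurable h) (hσ : 0 < σ) (hη : η < P.real {ω | h ω = 0}) :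
    capacity σ A P h η = 0 := by
  simp [capacity, not_isAchievable hh hσ hη]

lemma IsAchievable.le_half (hh : Measurable h) (hσ : 0 < σ) (hη : η < 1)
    (hR : IsAchievable σ A P h η R) : R ≤ 1 / 2 := by
  obtain ⟨K, hK0, hK⟩ := exists_lt_measureReal_abs_le (P := P) h hη
  by_contra! hlt
  have hsep : Real.exp ((K * (σ / K) / σ) ^ 2) * (1 / 5) < (1 - 1 / 5) ^ 2 := by
    rw [mul_div_cancel₀ _ hK0.ne', div_self hσ.ne', one_pow]
    linarith [Real.exp_one_lt_three]
  obtain ⟨n, hcode, hn⟩ := ((hR.2 (1 / 5) (1 / 5) (by norm_num) (by norm_num)).and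
    (eventually_one_add_mul_rpow_pow_lt (c := 2 * √A / (σ / K)) (by positivity)
      one_half_pos.le hlt)).exists
  have hcard := hcode.card_le hh hσ hK (by positivity) (by norm_num) hsep
  have hbase : 2 * √(n * A) / (σ / K) = 2 * √A / (σ / K) * (n : ℝ) ^ (1 / 2 : ℝ) := by
    rw [← Real.sqrt_eq_rpow, Real.sqrt_mul n.cast_nonneg]
    ring
  rw [hbase] at hcard
  exact (hn.trans_le (Nat.le_ceil _)).not_ge hcard

lemma isAchievable_of_lt (hh : Measurable h) (hσ : 0 < σ) (hA : 0 < A)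
    (hη : P.real {ω | h ω = 0} < η) (hR0 : 0 < R) (hR : R < 1 / 4) :
    IsAchievable σ A P h η R := by
  obtain ⟨γ, hγ0, hγ⟩ := exists_le_measureReal_le_abs hh hη
  obtain ⟨s, hs, hsR⟩ := exists_between (show 1 / 4 < 1 / 2 - R by linarith)
  refine ⟨hR0, fun lam₁ lam₂ hlam₁ hlam₂ => ?_⟩
  obtain ⟨T, hT⟩ : ∃ T, Real.exp (4 - T) = lam₁ := ⟨4 - Real.log lam₁, by simp [Real.exp_log hlam₁]⟩
  filter_upwards [eventually_natCeil_rpow_le (Real.sqrt_pos.2 hA) hR0.le (lt_sub_comm.1 hsR),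
    (tendsto_sq_mul_rpow_div_sqrt_add_atTop hσ hγ0 hs).eventually_ge_atTop
      (T + 2 - Real.log lam₂), eventually_ge_atTop 16] with n hcard hII hn
  have hn0 : (0 : ℝ) < n := by exact_mod_cast (by omega : 0 < n)
  have hratio : √A * (n : ℝ) ^ (1 / 2 - s) = √(n * A) / (n : ℝ) ^ s := by
    rw [Real.rpow_sub hn0, ← Real.sqrt_eq_rpow, Real.sqrt_mul hn0.le]
    ring
  rw [hratio] at hcard
  refine (ExistsDICode.of_card_le hσ hA.le hγ0.le hγ (by positivity) hn hcard T).mono hT.le ?_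
  rw [← Real.le_log_iff_exp_le hlam₂]
  linarith

lemma capacity_le_half (hh : Measurable h) (hσ : 0 < σ) (hη : η < 1) :
    capacity σ A P h η ≤ 1 / 2 :=
  iSup₂_le fun _ hR => (ENNReal.ofReal_le_ofReal (hR.le_half hh hσ hη)).trans_eq (by simp)

lemma quarter_le_capacity (hh : Measurable h) (hσ : 0 < σ) (hA : 0 < A)
    (hη : P.real {ω | h ω = 0} < η) : 1 / 4 ≤ capacity σ A P h η := by
  refine ENNReal.le_of_forall_nnreal_lt fun R hR => ?_
  obtain rfl | hR0 := eq_or_ne R 0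
  · simp
  have hR' : (R : ℝ) < 1 / 4 := by
    simpa using (ENNReal.toReal_lt_toReal ENNReal.coe_ne_top (by simp)).2 hR
  exact le_iSup₂_of_le (R : ℝ) (isAchievable_of_lt hh hσ hA hη (by positivity) hR') (by simp)

end Capacity

end SlowFading

theorem mainTheorem2 {Ω : Type*} [MeasurableSpace Ω] (P : Measure Ω) [IsProbabilityMeasure P]
    (h : Ω → ℝ) (hh : Measurable h) (σ A : ℝ) (hσ : 0 < σ) (hA : 0 < A) (η : ℝ) :
    (η < P.real {ω | h ω = 0} →
      SlowFading.capacity σ A P h η = 0 ∧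
      ∀ (M n : ℕ) (lam₁ lam₂ : ℝ), lam₁ + lam₂ < 1 →
        SlowFading.ExistsDICode σ A P h M n lam₁ lam₂ η → M ≤ 1) ∧
    (P.real {ω | h ω = 0} < η → η < 1 →
      1 / 4 ≤ SlowFading.capacity σ A P h η ∧ SlowFading.capacity σ A P h η ≤ 1 / 2) :=
  ⟨fun hη => ⟨SlowFading.capacity_eq_zero hh hσ hη,
    fun _ _ _ _ hlam hM => hM.card_le_one hh hσ hη hlam⟩,
  fun hη hη1 => ⟨SlowFading.quarter_le_capacity hh hσ hA hη,
    SlowFading.capacity_le_half hh hσ hη1⟩⟩
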